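/- **Conventions.** $K$ is a separable complex Hilbert space. $\mathrm{DO}(K)$ is the set of nonzero positive trace-class operators on $K$ (not necessarily of trace $1$). A *measurement* over a Hilbert space is a countable indexed family $\langle L_i : i\in I\rangle$ of bounded operators on it with $\sum_i L_i^\dagger L_i=\mathrm{Id}$ in the weak operator topology; the elements of $I$ are its outcomes. In state $\sigma$ the outcome $i$ has probability $\mathrm{Tr}(L_i\sigma L_i^\dagger)/\mathrm{Tr}(\sigma)$ and post-measurement state $L_i\sigma L_i^\dagger$ (not normalized). The product of the probabilities of successive outcomes is taken to be $0$ as soon as one of them is $0$. **Measurement trees.** A measurement tree $T$ over $K$ is a directed rooted tree with a finite bound on the lengths of its branches, where every non-leaf node $x$ carries a measurement $M_x$ over $K$ and the edges emanating from $x$ are labelled one-to-one with the outcomes of $M_x$. A branch is a sequence $\beta=(o_1,\dots,o_N)$ of labels leading from the root to a leaf. On input $\sigma\in\mathrm{DO}(K)$ one successively performs the measurements at the nodes reached. $\mathrm{Out}_T(\beta|\sigma)$ is the state resulting from the outcomes $o_1,\dots,o_N$, and $P_T(\beta|\sigma)=p_1p_2\cdots p_N$, where $p_k$ is the probability of $o_k$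 in the state reached before it. **Circuits.** A quantum circuit $C$ with full inputs and outputs in $K$ consists of: a factorization of $K$ as the Hilbert tensor product of the spaces of finitely many registers (quantum wires); finitely many gates; for every register, a list without repetitions of the gates its wire passes through, in order; a relation "$F$ is a classical source of $G$" (there is a classical channel from $F$ to $G$) on gates; for every gate $G$, a finite nonempty set of $G$-measurements, with pairwise disjoint outcome sets, over the tensor product of the spaces of the registers whose wires pass through $G$, and a selection function $\Sigma_G$ mapping families of outcomes of the classical sources of $G$ onto the set of $G$-measurements; and a schedule $(B_1,\dots,B_N)$ of disjoint nonempty sets of gates (bouts) covering all gates, such that whenever $G\in B_n$ and $F$ is a classical source of $G$ or precedes $G$ on some wire, $F\in B_k$ for some $k<n$. A path $\mu$ through $C$ assigns to every gate $G$ an outcome $\mu(G)$ of the $G$-measurement $\Sigma_G\langle\mu(F): F \text{ a classical source of } G\rangle$. Along $\mu$, bout $B_n$ performs the operator $A_n^\mu$ on $K$ that is the tensor product of the operators belonging to the outcomes $\mu(G)$, $G\in B_n$, and of the identities on the registers not touched by $B_n$. With $\sigma_0=\sigma$ and $\sigma_n=A_n^\mu\sigma_{n-1}(A_n^\mu)^\dagger$,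 put $\mathrm{Out}_C(\mu|\sigma)=\sigma_N$ and $P_C(\mu|\sigma)=\prod_{n=1}^N \mathrm{Tr}(\sigma_n)/\mathrm{Tr}(\sigma_{n-1})$. **Theorem (Reduction).** Let $C$ be a quantum circuit with full inputs and outputs in $K$. There exist a measurement tree $T$ over $K$ and a bijection $\mu\mapsto\beta_\mu$ from the set of paths through $C$ onto the set of branches of $T$ such that for every path $\mu$ through $C$ and every $\sigma\in\mathrm{DO}(K)$: 1. $\mathrm{Out}_C(\mu|\sigma)=\mathrm{Out}_T(\beta_\mu|\sigma)$, and 2. $P_C(\mu|\sigma)=P_T(\beta_\mu|\sigma)$. -/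

import Mathlib

open scoped InnerProductSpace ComplexOrder ComplexConjugate

universe u v

/-! ### Measurements, traces and density operators -/

/-- A (general) measurement over a complex Hilbert space `K`: a countable indexed family
`⟨L i : i ∈ I⟩` of bounded operators on `K` such that `∑ i, (L i)† L i` converges to the identity
in the weak operator topology. The elements of the index type are the (classical) outcomes. -/
structure Measurement (K : Type u) [NormedAddCommGroup K] [InnerProductSpace ℂ K]
    [CompleteSpace K] where
  Outcome : Type v
  countable_outcome : Countable Outcome
  op : Outcome → (K →L[ℂ] K)
  hasSum_id : HasSum
    (fun i => ContinuousLinearMapWOT.ofCLM (ContinuousLinearMap.adjoint (op i) * op i))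
    (ContinuousLinearMapWOT.ofCLM (1 : K →L[ℂ] K))

section Density

variable {K : Type*} [NormedAddCommGroup K] [InnerProductSpace ℂ K] [CompleteSpace K]

/-- The index set of a fixed Hilbert basis of `K` (used only to define traces). -/
noncomputable def traceBasisIndex (K : Type*) [NormedAddCommGroup K] [InnerProductSpace ℂ K]
    [CompleteSpace K] : Set K :=
  (exists_hilbertBasis ℂ K).choose

/-- A fixed Hilbert basis of `K` (used only to define traces). -/
noncomputable def traceBasis (K : Type*) [NormedAddCommGroup K] [InnerProductSpace ℂ K]
    [CompleteSpace K] : HilbertBasis (traceBasisIndex K) ℂ K :=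
  (exists_hilbertBasis ℂ K).choose_spec.choose

/-- A positive operator is trace class if `∑ e, ⟨e, σ e⟩` is finite, `e` ranging over a Hilbert
basis. (For positive operators neither this nor the value of the sum depends on the basis.) -/
def IsTraceClass (σ : K →L[ℂ] K) : Prop :=
  Summable fun e : traceBasisIndex K => (⟪traceBasis K e, σ (traceBasis K e)⟫_ℂ).re

/-- The trace `∑ e, ⟨e, σ e⟩` of a positive trace-class operator. -/
noncomputable def opTrace (σ : K →L[ℂ] K) : ℝ :=
  ∑' e : traceBasisIndex K, (⟪traceBasis K e, σ (traceBasis K e)⟫_ℂ).re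

/-- `DO(K)`: nonzero positive (semidefinite, Hermitian) trace-class operators,
not necessarily normalized. -/
structure DensityOperator (K : Type*) [NormedAddCommGroup K] [InnerProductSpace ℂ K]
    [CompleteSpace K] where
  op : K →L[ℂ] K
  ne_zero : op ≠ 0
  isPositive : op.IsPositive
  isTraceClass : IsTraceClass op

/-- The unnormalized post-measurement state `L σ L†`. -/
noncomputable def postState (L σ : K →L[ℂ] K) : K →L[ℂ] K :=
  L * σ * ContinuousLinearMap.adjoint L

/-- The probability `Tr (L σ L†) / Tr σ` of the outcome with operator `L` in state `σ`. -/
noncomputable def outcomeProb (L σ : K →L[ℂ] K) : ℝ :=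
  opTrace (postState L σ) / opTrace σ

/-- The final state when successive measurements, started in state `σ`, produce the outcomes
whose operators are the entries of the list (first entry first). -/
noncomputable def runState : List (K →L[ℂ] K) → (K →L[ℂ] K) → (K →L[ℂ] K)
  | [], σ => σ
  | L :: Ls, σ => runState Ls (postState L σ)

/-- The probability `p₁ p₂ ⋯ p_N` that successive measurements, started in state `σ`, produce the
outcomes whose operators are the entries of the list: `p_{k+1}` is the probability of the
`(k+1)`-st outcome in the state reached after the first `k` ones. (Once some `p_k = 0`, the state
is the zero operator and the product is `0`.) -/
noncomputable def runProb : List (K →L[ℂ] K) → (K →L[ℂ] K) → ℝ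
  | [], _ => 1
  | L :: Ls, σ => outcomeProb L σ * runProb Ls (postState L σ)

end Density

/-! ### Measurement trees -/

/-- Well-founded rooted trees in which every non-leaf node carries a measurement over `K` and has
exactly one outgoing edge for every outcome of that measurement. -/
inductive OutcomeTree (K : Type u) [NormedAddCommGroup K] [InnerProductSpace ℂ K]
    [CompleteSpace K] : Type (max u (v + 1))
  | leaf : OutcomeTree K
  | node (M : Measurement.{u, v} K) (child : M.Outcome → OutcomeTree K) : OutcomeTree K

namespace OutcomeTree

variable {K : Type u} [NormedAddCommGroup K] [InnerProductSpace ℂ K] [CompleteSpace K]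

/-- Branches: sequences `(o₁, …, o_N)` of edge labels leading from the root to a leaf. -/
def Branch : OutcomeTree.{u, v} K → Type v
  | leaf => PUnit
  | node M child => Σ o : M.Outcome, Branch (child o)

/-- The length of a branch. -/
def branchLength : (T : OutcomeTree.{u, v} K) → T.Branch → ℕ
  | leaf, _ => 0
  | node _ child, ⟨o, b⟩ => branchLength (child o) b + 1

/-- The operators belonging to the successive outcomes along a branch. -/
def branchOps : (T : OutcomeTree.{u, v} K) → T.Branch → List (K →L[ℂ] K)
  | leaf, _ => []
  | node M child, ⟨o, b⟩ => M.op o :: branchOps (child o) b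

end OutcomeTree

/-- A measurement tree over `K`: there is a finite bound on the lengths of branches. -/
structure MeasTree (K : Type u) [NormedAddCommGroup K] [InnerProductSpace ℂ K]
    [CompleteSpace K] where
  tree : OutcomeTree.{u, v} K
  bounded : ∃ N : ℕ, ∀ b : tree.Branch, tree.branchLength b ≤ N

namespace MeasTree

variable {K : Type u} [NormedAddCommGroup K] [InnerProductSpace ℂ K] [CompleteSpace K]

/-- The branches of a measurement tree. -/
abbrev Branch (T : MeasTree.{u, v} K) : Type v := T.tree.Branch

/-- `Out_T(b | σ)`. -/
noncomputable def out (T : MeasTree.{u, v} K) (b : T.Branch) (σ : DensityOperator K) :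
    K →L[ℂ] K :=
  runState (T.tree.branchOps b) σ.op

/-- `P_T(b | σ)`. -/
noncomputable def prob (T : MeasTree.{u, v} K) (b : T.Branch) (σ : DensityOperator K) : ℝ :=
  runProb (T.tree.branchOps b) σ.op

end MeasTree

/-! ### Tensor products of Hilbert spaces and of operators -/

/-- A realization of `K` as the Hilbert tensor product of the finite family `H`: a multilinear
map `x ↦ ⨂ i, x i` with `⟨⨂ x i, ⨂ y i⟩ = ∏ ⟨x i, y i⟩` whose values span a dense subspace.
This determines the Hilbert space `K` up to a unique unitary compatible with `⨂`. -/
structure HilbertTensor {ι : Type*} [Fintype ι] (H : ι → Type*)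
    [∀ i, NormedAddCommGroup (H i)] [∀ i, InnerProductSpace ℂ (H i)]
    (K : Type*) [NormedAddCommGroup K] [InnerProductSpace ℂ K] where
  tprod : MultilinearMap ℂ H K
  inner_tprod : ∀ x y : (∀ i, H i), ⟪tprod x, tprod y⟫_ℂ = ∏ i, ⟪x i, y i⟫_ℂ
  dense_span : Dense (Submodule.span ℂ (Set.range tprod) : Set K)

section TensorOp

/-- A `2 × 2` block kernel with corners `C • k`, `m`, `m†`, `C • k`. -/
def blockKernel {X : Type*} (C : ℝ) (k m : X → X → ℂ) : Matrix (X ⊕ X) (X ⊕ X) ℂ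
  | .inl y, .inl y' => C * k y y'
  | .inl y, .inr x => m y x
  | .inr x, .inl y => conj (m y x)
  | .inr x, .inr x' => C * k x x'

theorem kernel_sum_eq {K X : Type*} [NormedAddCommGroup K] [InnerProductSpace ℂ K]
    (t : X → K) (C : ℝ) (u : X →₀ ℂ) :
    (u.sum fun i a => u.sum fun j b => star a * (C * ⟪t i, t j⟫_ℂ) * b)
        = ((C * ‖Finsupp.linearCombination ℂ t u‖ ^ 2 : ℝ) : ℂ) := by
  have : ((‖Finsupp.linearCombination ℂ t u‖ ^ 2 : ℝ) : ℂ) =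
      ⟪Finsupp.linearCombination ℂ t u, Finsupp.linearCombination ℂ t u⟫_ℂ := by
    rw [inner_self_eq_norm_sq_to_K]; norm_cast
  rw [Complex.ofReal_mul, this]
  simp only [Finsupp.linearCombination_apply, Finsupp.sum, sum_inner, inner_sum,
    inner_smul_left, inner_smul_right, Finset.mul_sum, RCLike.star_def]
  rw [Finset.sum_comm]
  refine Finset.sum_congr rfl fun i _ => Finset.sum_congr rfl fun j _ => ?_
  ring

theorem norm_le_of_blockKernel {K X : Type*} [NormedAddCommGroup K] [InnerProductSpace ℂ K]
    (t : X → K) (m : X → X → ℂ) (C : ℝ) (hC : 0 ≤ C)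
    (hpos : (blockKernel C (fun x y => ⟪t x, t y⟫_ℂ) m).PosSemidef) (w v : X →₀ ℂ) :
    ‖w.sum fun y d => conj d * Finsupp.linearCombination ℂ (m y) v‖ ≤
      C * ‖Finsupp.linearCombination ℂ t w‖ * ‖Finsupp.linearCombination ℂ t v‖ := by
  classical
  have key : ∀ w v : X →₀ ℂ, 0 ≤ C * ‖Finsupp.linearCombination ℂ t w‖ ^ 2
      + 2 * (w.sum fun y d => conj d * Finsupp.linearCombination ℂ (m y) v).re
      + C * ‖Finsupp.linearCombination ℂ t v‖ ^ 2 := by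
    intro w v
    have h := hpos.2 (Finsupp.sumElim w v)
    simp only [Finsupp.sum_sumElim, Function.comp_def, blockKernel] at h
    have e1 := kernel_sum_eq t C
    have e2 : (w.sum fun i a => v.sum fun j b => star a * m i j * b) =
        w.sum fun y d => conj d * Finsupp.linearCombination ℂ (m y) v := by
      simp only [Finsupp.linearCombination_apply, Finsupp.sum, Finset.mul_sum, smul_eq_mul,
        RCLike.star_def]
      refine Finset.sum_congr rfl fun i _ => Finset.sum_congr rfl fun j _ => ?_
      ring
    have e3 : (v.sum fun i a => w.sum fun j b => star a * conj (m j i) * b) =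
        conj (w.sum fun y d => conj d * Finsupp.linearCombination ℂ (m y) v) := by
      rw [← e2]
      simp only [Finsupp.sum, map_sum, map_mul, RCLike.star_def, Complex.conj_conj]
      rw [Finset.sum_comm]
      refine Finset.sum_congr rfl fun i _ => Finset.sum_congr rfl fun j _ => ?_
      ring
    have h2 : ∀ (u : X →₀ ℂ) (F G : X → ℂ → ℂ), (u.sum fun i a => F i a + G i a) =
        u.sum F + u.sum G := fun u F G => Finset.sum_add_distrib
    rw [h2, h2, e1, e1, e2, e3] at h
    have h3 := (Complex.le_def.1 h).1
    simp only [Complex.add_re, Complex.ofReal_re, Complex.conj_re, Complex.zero_re] at h3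
    linarith
  set s := w.sum fun y d => conj d * Finsupp.linearCombination ℂ (m y) v with hs
  set A := ‖Finsupp.linearCombination ℂ t w‖
  set B := ‖Finsupp.linearCombination ℂ t v‖
  have hd := discrim_le_zero (a := C * A ^ 2 * ‖s‖ ^ 2) (b := -(2 * ‖s‖ ^ 2)) (c := C * B ^ 2) (by
    intro r
    have := key ((-(r : ℂ) * s) • w) v
    rw [map_smul, norm_smul, Finsupp.sum_smul_index (by simp)] at this
    have e : (w.sum fun i a => conj (-(r : ℂ) * s * a) * Finsupp.linearCombination ℂ (m i) v)
        = ((-(r * ‖s‖ ^ 2) : ℝ) : ℂ) := by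
      have e0 : ∀ c : ℂ, (w.sum fun i a => conj (c * a) * Finsupp.linearCombination ℂ (m i) v)
          = conj c * s := by
        intro c
        rw [hs]
        simp only [Finsupp.sum, map_mul, Finset.mul_sum]
        refine Finset.sum_congr rfl fun i _ => ?_
        ring
      rw [e0]
      have : ((-(r * ‖s‖ ^ 2) : ℝ) : ℂ) = -(r : ℂ) * (conj s * s) := by
        rw [← Complex.normSq_eq_conj_mul_self, Complex.normSq_eq_norm_sq]; push_cast; ring
      rw [this]
      simp only [map_mul, map_neg, Complex.conj_ofReal]
      ring
    rw [e, Complex.ofReal_re] at this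
    have e' : ‖-(r : ℂ) * s‖ ^ 2 = r ^ 2 * ‖s‖ ^ 2 := by
      rw [norm_mul, norm_neg, Complex.norm_real, mul_pow, Real.norm_eq_abs, sq_abs]
    have e'' : C * (‖-(r : ℂ) * s‖ * ‖Finsupp.linearCombination ℂ t w‖) ^ 2
        = C * A ^ 2 * ‖s‖ ^ 2 * (r * r) := by rw [mul_pow, e']; ring
    rw [e''] at this
    linarith)
  unfold discrim at hd
  by_contra hlt
  push Not at hlt
  have hA : 0 ≤ A := norm_nonneg _
  have hB : 0 ≤ B := norm_nonneg _
  have hp : 0 ≤ C * A * B := by positivity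
  have hspos : 0 < ‖s‖ := lt_of_le_of_lt hp hlt
  have h4 : (C * A * B) ^ 2 < ‖s‖ ^ 2 := by gcongr
  have : ‖s‖ ^ 2 * ‖s‖ ^ 2 ≤ ‖s‖ ^ 2 * (C * A * B) ^ 2 := by nlinarith
  have := le_of_mul_le_mul_left this (by positivity)
  linarith

theorem existsUnique_op_of_blockKernel {K X : Type*} [NormedAddCommGroup K]
    [InnerProductSpace ℂ K] [CompleteSpace K]
    (t : X → K) (ht : Dense (Submodule.span ℂ (Set.range t) : Set K))
    (m : X → X → ℂ) (C : ℝ) (hC : 0 ≤ C)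
    (hpos : (blockKernel C (fun x y => ⟪t x, t y⟫_ℂ) m).PosSemidef) :
    ∃! T : K →L[ℂ] K, ∀ x y, ⟪t y, T (t x)⟫_ℂ = m y x := by
  have hd : DenseRange (Finsupp.linearCombination ℂ t) := by
    rw [DenseRange, ← LinearMap.coe_range, Finsupp.range_linearCombination]
    exact ht
  have hb := norm_le_of_blockKernel t m C hC hpos
  have hu : ∀ y, ∃ u : K, ∀ v, ⟪u, Finsupp.linearCombination ℂ t v⟫_ℂ =
      Finsupp.linearCombination ℂ (m y) v := by
    intro y
    have hy : ∃ D : ℝ, ∀ v, ‖Finsupp.linearCombination ℂ (m y) v‖ ≤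
        D * ‖Finsupp.linearCombination ℂ t v‖ :=
      ⟨C * ‖t y‖, fun v => by simpa using hb (Finsupp.single y 1) v⟩
    refine ⟨(InnerProductSpace.toDual ℂ K).symm ((Finsupp.linearCombination ℂ (m y)).extendOfNorm
      (Finsupp.linearCombination ℂ t)), fun v => ?_⟩
    rw [InnerProductSpace.toDual_symm_apply, LinearMap.extendOfNorm_eq hd hy]
  choose u hu using hu
  have hsum : ∀ w v, ⟪Finsupp.linearCombination ℂ u w, Finsupp.linearCombination ℂ t v⟫_ℂ =
      w.sum fun y d => conj d * Finsupp.linearCombination ℂ (m y) v := by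
    intro w v
    rw [Finsupp.linearCombination_apply ℂ w, Finsupp.sum, sum_inner]
    refine Finset.sum_congr rfl fun y _ => ?_
    rw [inner_smul_left, hu]
  have hn : ∀ w, ‖Finsupp.linearCombination ℂ u w‖ ≤ C * ‖Finsupp.linearCombination ℂ t w‖ := by
    intro w
    have h1 : ∀ z, ‖⟪Finsupp.linearCombination ℂ u w, z⟫_ℂ‖ ≤
        C * ‖Finsupp.linearCombination ℂ t w‖ * ‖z‖ := by
      intro z
      refine hd.induction_on (p := fun z => ‖⟪Finsupp.linearCombination ℂ u w, z⟫_ℂ‖ ≤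
        C * ‖Finsupp.linearCombination ℂ t w‖ * ‖z‖) z
        (isClosed_le (by fun_prop) (by fun_prop)) fun v => ?_
      rw [hsum]
      exact hb w v
    have h2 := h1 (Finsupp.linearCombination ℂ u w)
    rw [inner_self_eq_norm_sq_to_K] at h2
    rw [norm_pow, RCLike.norm_ofReal, abs_norm, sq] at h2
    rcases (norm_nonneg (Finsupp.linearCombination ℂ u w)).eq_or_lt with h0 | h0
    · rw [← h0]; positivity
    · exact le_of_mul_le_mul_right h2 h0
  refine existsUnique_of_exists_of_unique ⟨ContinuousLinearMap.adjoint ((Finsupp.linearCombination ℂ u).extendOfNorm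
    (Finsupp.linearCombination ℂ t)), fun x y => ?_⟩ fun T T' hT hT' => ?_
  · rw [ContinuousLinearMap.adjoint_inner_right]
    have h1 := LinearMap.extendOfNorm_eq (f := Finsupp.linearCombination ℂ u) hd ⟨C, hn⟩
      (Finsupp.single y 1)
    have h2 := hu y (Finsupp.single x 1)
    simp only [Finsupp.linearCombination_single, one_smul] at h1 h2
    rw [h1, h2]
  · refine ContinuousLinearMap.ext_on ht ?_
    rintro _ ⟨x, rfl⟩
    have h : innerSL ℂ (T (t x)) = innerSL ℂ (T' (t x)) := by
      refine ContinuousLinearMap.ext_on ht ?_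
      rintro _ ⟨y, rfl⟩
      have := congrArg conj ((hT x y).trans (hT' x y).symm)
      simpa only [innerSL_apply_apply, inner_conj_symm] using this
    exact (innerSL_inj (𝕜 := ℂ)).1 h

theorem posSemidef_blockKernel_op {L X : Type*} [NormedAddCommGroup L] [InnerProductSpace ℂ L]
    (A : L →L[ℂ] L) (C : ℝ) (hA : ‖A‖ ≤ C) (t : X → L) :
    (blockKernel C (fun x y => ⟪t x, t y⟫_ℂ) (fun y x => ⟪t y, A (t x)⟫_ℂ)).PosSemidef := by
  classical
  refine ⟨?_, fun z => ?_⟩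
  · ext i j
    rcases i with i | i <;> rcases j with j | j <;>
      simp [blockKernel, Matrix.conjTranspose_apply, inner_conj_symm]
  · obtain ⟨w, v, rfl⟩ : ∃ w v, z = Finsupp.sumElim w v :=
      ⟨_, _, (Finsupp.sumFinsuppEquivProdFinsupp.symm_apply_apply z).symm⟩
    simp only [Finsupp.sum_sumElim, Function.comp_def, blockKernel]
    have h2 : ∀ (u : X →₀ ℂ) (F G : X → ℂ → ℂ), (u.sum fun i a => F i a + G i a) =
        u.sum F + u.sum G := fun u F G => Finset.sum_add_distrib
    have e2 : (w.sum fun i a => v.sum fun j b => star a * ⟪t i, A (t j)⟫_ℂ * b) =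
        ⟪Finsupp.linearCombination ℂ t w, A (Finsupp.linearCombination ℂ t v)⟫_ℂ := by
      simp only [Finsupp.linearCombination_apply, Finsupp.sum, map_sum, map_smul, sum_inner,
        inner_sum, inner_smul_left, inner_smul_right, RCLike.star_def, Finset.mul_sum]
      rw [Finset.sum_comm]
      refine Finset.sum_congr rfl fun i _ => Finset.sum_congr rfl fun j _ => ?_
      ring
    have e3 : (v.sum fun i a => w.sum fun j b => star a * conj ⟪t j, A (t i)⟫_ℂ * b) =
        conj ⟪Finsupp.linearCombination ℂ t w, A (Finsupp.linearCombination ℂ t v)⟫_ℂ := by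
      rw [← e2]
      simp only [Finsupp.sum, map_sum, map_mul, RCLike.star_def, Complex.conj_conj]
      rw [Finset.sum_comm]
      refine Finset.sum_congr rfl fun i _ => Finset.sum_congr rfl fun j _ => ?_
      ring
    rw [h2, h2, kernel_sum_eq, kernel_sum_eq, e2, e3]
    set η := Finsupp.linearCombination ℂ t w
    set ξ := Finsupp.linearCombination ℂ t v
    have hn : ‖⟪η, A ξ⟫_ℂ‖ ≤ C * ‖η‖ * ‖ξ‖ :=
      calc ‖⟪η, A ξ⟫_ℂ‖ ≤ ‖η‖ * ‖A ξ‖ := norm_inner_le_norm _ _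
        _ ≤ ‖η‖ * (C * ‖ξ‖) := by gcongr; exact A.le_of_opNorm_le hA ξ
        _ = C * ‖η‖ * ‖ξ‖ := by ring
    have hr := (abs_le.1 ((Complex.abs_re_le_norm ⟪η, A ξ⟫_ℂ).trans hn)).1
    have hC : 0 ≤ C := (norm_nonneg A).trans hA
    rw [Complex.le_def]
    refine ⟨?_, by
      simp only [Complex.add_im, Complex.ofReal_im, Complex.conj_im, Complex.zero_im]; ring⟩
    simp only [Complex.add_re, Complex.ofReal_re, Complex.conj_re, Complex.zero_re]
    nlinarith [mul_nonneg hC (sq_nonneg (‖η‖ - ‖ξ‖)),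
      mul_nonneg hC (sq_nonneg ‖η‖), mul_nonneg hC (sq_nonneg ‖ξ‖)]

theorem posSemidef_prod {ι X : Type*} (s : Finset ι) (M : ι → Matrix X X ℂ)
    (h : ∀ i ∈ s, (M i).PosSemidef) :
    (Matrix.of fun x y => ∏ i ∈ s, M i x y : Matrix X X ℂ).PosSemidef := by
  classical
  induction s using Finset.induction_on with
  | empty =>
    refine ⟨by ext; simp, fun x => ?_⟩
    have : (x.sum fun i xi => x.sum fun j xj => star xi * (1 : ℂ) * xj) =
        star (x.sum fun _ a => a) * (x.sum fun _ a => a) := by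
      simp [Finsupp.sum, Finset.sum_mul_sum]
    simp only [Finset.prod_empty, Matrix.of_apply]
    rw [this]
    exact star_mul_self_nonneg _
  | insert a s ha ih =>
    have h1 := (h a (Finset.mem_insert_self a s)).hadamard
      (ih fun i hi => h i (Finset.mem_insert_of_mem hi))
    have e : (Matrix.of fun x y => ∏ i ∈ insert a s, M i x y : Matrix X X ℂ) =
        (M a).hadamard (Matrix.of fun x y => ∏ i ∈ s, M i x y) := by
      ext x y
      simp [Finset.prod_insert ha, Matrix.hadamard]
    rw [e]
    exact h1

/-- Existence and uniqueness of tensor products of bounded operators: for operators `A g` on the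
Hilbert tensor products `L g` of pairwise disjoint subfamilies of `H`, there is exactly one bounded
operator on `K = ⨂ i, H i` that acts as `⨂ g, A g` on these factors and as the identity on the
remaining ones, i.e. whose matrix elements between product vectors are the products of the matrix
elements of its tensor factors. -/
theorem HilbertTensor.existsUnique_tensorOp {ι γ : Type*} [Fintype ι] {H : ι → Type*}
    [∀ i, NormedAddCommGroup (H i)] [∀ i, InnerProductSpace ℂ (H i)]
    {K : Type*} [NormedAddCommGroup K] [InnerProductSpace ℂ K] [CompleteSpace K]
    {L : γ → Type*} [∀ g, NormedAddCommGroup (L g)] [∀ g, InnerProductSpace ℂ (L g)]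
    (τ : HilbertTensor H K) (J : Finset γ) (S : γ → ι → Prop) [∀ g, DecidablePred (S g)]
    (hS : ∀ g ∈ J, ∀ g' ∈ J, ∀ i, S g i → S g' i → g = g')
    (τL : ∀ g, HilbertTensor (fun i : {i // S g i} => H i) (L g))
    (A : ∀ g, L g →L[ℂ] L g) :
    ∃! T : K →L[ℂ] K, ∀ x y : (∀ i, H i), ⟪τ.tprod y, T (τ.tprod x)⟫_ℂ =
      (∏ g ∈ J, ⟪(τL g).tprod (fun i => y i), A g ((τL g).tprod (fun i => x i))⟫_ℂ) *
        ∏ i with ∀ g ∈ J, ¬ S g i, ⟪y i, x i⟫_ℂ := by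
  classical
  refine existsUnique_op_of_blockKernel (fun x : (∀ i, H i) => τ.tprod x) τ.dense_span
    (fun y x => (∏ g ∈ J, ⟪(τL g).tprod (fun i => y i), A g ((τL g).tprod (fun i => x i))⟫_ℂ) *
        ∏ i with ∀ g ∈ J, ¬ S g i, ⟪y i, x i⟫_ℂ) (∏ g ∈ J, ‖A g‖)
    (Finset.prod_nonneg fun g _ => norm_nonneg _) ?_
  have h1 := posSemidef_prod J
    (fun g => blockKernel ‖A g‖
      (fun x y : (∀ i, H i) => ⟪(τL g).tprod (fun i => x i), (τL g).tprod (fun i => y i)⟫_ℂ)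
      (fun y x => ⟪(τL g).tprod (fun i => y i), A g ((τL g).tprod (fun i => x i))⟫_ℂ))
    (fun g _ => posSemidef_blockKernel_op (A g) _ le_rfl
      (fun x : (∀ i, H i) => (τL g).tprod (fun i => x i)))
  have h2 := posSemidef_prod (Finset.univ.filter fun i => ∀ g ∈ J, ¬ S g i)
    (fun i => blockKernel 1 (fun x y : (∀ i, H i) => ⟪x i, y i⟫_ℂ)
      (fun y x => ⟪y i, x i⟫_ℂ))
    (fun i _ => posSemidef_blockKernel_op (ContinuousLinearMap.id ℂ (H i)) 1
      ContinuousLinearMap.norm_id_le (fun x : (∀ i, H i) => x i))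
  have hk : ∀ x y : (∀ i, H i), ⟪τ.tprod x, τ.tprod y⟫_ℂ =
      (∏ g ∈ J, ⟪(τL g).tprod (fun i => x i), (τL g).tprod (fun i => y i)⟫_ℂ) *
        ∏ i with ∀ g ∈ J, ¬ S g i, ⟪x i, y i⟫_ℂ := by
    intro x y
    rw [τ.inner_tprod, ← Finset.prod_filter_not_mul_prod_filter Finset.univ
      (fun i => ∀ g ∈ J, ¬ S g i)]
    congr 1
    have e : (Finset.univ.filter fun i => ¬ ∀ g ∈ J, ¬ S g i) =
        J.biUnion fun g => Finset.univ.filter (S g) := by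
      ext i; simp
    rw [e, Finset.prod_biUnion]
    · refine Finset.prod_congr rfl fun g _ => ?_
      rw [(τL g).inner_tprod]
      exact Finset.prod_subtype (Finset.univ.filter (S g)) (by simp) (fun i => ⟪x i, y i⟫_ℂ)
    · intro g hg g' hg' hne
      rw [Function.onFun, Finset.disjoint_left]
      intro i hi hi'
      simp only [Finset.mem_filter, Finset.mem_univ, true_and] at hi hi'
      exact hne (hS g hg g' hg' i hi hi')
  have h3 := h1.hadamard h2
  refine Eq.mp (congrArg Matrix.PosSemidef ?_) h3
  ext a b
  rcases a with a | a <;> rcases b with b | b <;>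
    simp [blockKernel, hk, Finset.prod_mul_distrib, mul_assoc]
end TensorOp

/-! ### Quantum circuits -/

/-- Quantum circuits, with an execution schedule, whose full inputs and outputs are states in `K`.

* `K` is the tensor product of the Hilbert spaces of finitely many quantum registers.
* There are finitely many gates; `wire q` lists, in order, the gates that the quantum wire of the
  register `q` passes through. A gate `G` acts on the tensor product `gateSpace G` of the spaces of
  the registers whose wires pass through it.
* `Channel F G` says that there is a classical channel from `F` to `G`, i.e. that `F` is a classical
  source of `G`.
* Every gate `G` has a finite nonempty set of measurements over `gateSpace G`; outcomes of `G` are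
  pairs (measurement, outcome of it), so different measurements have disjoint outcome sets. The
  selection function picks the measurement to be executed from the outcomes of the classical
  sources, and no measurement is superfluous. (A unitary gate is a measurement with one outcome.)
* The schedule is a sequence of disjoint nonempty sets (bouts) of gates covering all gates, such
  that all quantum and classical prerequisites of a gate are in earlier bouts. -/
structure QuantumCircuit (K : Type u) [NormedAddCommGroup K] [InnerProductSpace ℂ K]
    [CompleteSpace K] where
  Reg : Type v
  [fintypeReg : Fintype Reg]
  regSpace : Reg → Type u
  [regNormed : ∀ q, NormedAddCommGroup (regSpace q)]
  [regInner : ∀ q, InnerProductSpace ℂ (regSpace q)]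
  [regComplete : ∀ q, CompleteSpace (regSpace q)]
  tensor : HilbertTensor regSpace K
  Gate : Type v
  [decEqGate : DecidableEq Gate]
  [finiteGate : Finite Gate]
  wire : Reg → List Gate
  wire_nodup : ∀ q, (wire q).Nodup
  gateSpace : Gate → Type u
  [gateNormed : ∀ G, NormedAddCommGroup (gateSpace G)]
  [gateInner : ∀ G, InnerProductSpace ℂ (gateSpace G)]
  [gateComplete : ∀ G, CompleteSpace (gateSpace G)]
  gateTensor : ∀ G, HilbertTensor (fun q : {q // G ∈ wire q} => regSpace q) (gateSpace G)
  Channel : Gate → Gate → Prop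
  MeasIdx : Gate → Type v
  finite_measIdx : ∀ G, Finite (MeasIdx G)
  nonempty_measIdx : ∀ G, Nonempty (MeasIdx G)
  meas : ∀ G, MeasIdx G → Measurement.{u, v} (gateSpace G)
  select : ∀ G, (∀ F : {F // Channel F G}, Σ i : MeasIdx F, (meas F i).Outcome) → MeasIdx G
  select_surjective : ∀ G, Function.Surjective (select G)
  numBouts : ℕ
  bout : Fin numBouts → Finset Gate
  bout_nonempty : ∀ n, (bout n).Nonempty
  bout_disjoint : ∀ m n, m ≠ n → Disjoint (bout m) (bout n)
  bout_cover : ∀ G, ∃ n, G ∈ bout n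
  bout_prereq : ∀ n, ∀ G ∈ bout n, ∀ F,
    (Channel F G ∨ ∃ q, [F, G].Sublist (wire q)) → ∃ k < n, F ∈ bout k

namespace QuantumCircuit

attribute [instance] fintypeReg regNormed regInner regComplete decEqGate finiteGate
  gateNormed gateInner gateComplete

variable {K : Type u} [NormedAddCommGroup K] [InnerProductSpace ℂ K] [CompleteSpace K]
  (C : QuantumCircuit.{u, v} K)

/-- Outcomes of the gate `G`: a `G` measurement together with an outcome of it. -/
abbrev GateOutcome (G : C.Gate) : Type v := Σ i : C.MeasIdx G, (C.meas G i).Outcome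

/-- A (computation) path: an outcome `μ(G)` for every gate `G`, coherent in the sense that `μ(G)` is
an outcome of the `G` measurement selected by the outcomes of the classical sources of `G`. -/
structure Path where
  outcome : ∀ G, C.GateOutcome G
  coherent : ∀ G, (outcome G).1 = C.select G fun F => outcome F

variable {C}

/-- The operator on `gateSpace G` belonging to the outcome `μ(G)`. -/
def gateOp (μ : C.Path) (G : C.Gate) : C.gateSpace G →L[ℂ] C.gateSpace G :=
  (C.meas G (μ.outcome G).1).op (μ.outcome G).2

/-- Gates of the same bout act on disjoint sets of registers. -/
theorem bout_wire_disjoint (n : Fin C.numBouts) :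
    ∀ G ∈ C.bout n, ∀ G' ∈ C.bout n, ∀ q, G ∈ C.wire q → G' ∈ C.wire q → G = G' := by
  intro G hG G' hG' q hq hq'
  by_contra hne
  have main : ∀ F F', F ∈ C.bout n → F' ∈ C.bout n → ¬ [F, F'].Sublist (C.wire q) := by
    intro F F' hF hF' hs
    obtain ⟨k, hk, hFk⟩ := C.bout_prereq n F' hF' F (Or.inr ⟨q, hs⟩)
    exact Finset.disjoint_left.1 (C.bout_disjoint k n hk.ne) hFk hF
  obtain ⟨l₁, l₂, hl⟩ := List.append_of_mem hq
  rw [hl] at hq'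
  rcases List.mem_append.1 hq' with h | h
  · refine main G' G hG' hG ?_
    rw [hl]
    exact (List.singleton_sublist.2 h).append (List.singleton_sublist.2 (by simp))
  · refine main G G' hG hG' ?_
    rw [hl]
    refine List.Sublist.trans ?_ (List.sublist_append_right l₁ (G :: l₂))
    have h' : G' ∈ l₂ := by
      rcases List.mem_cons.1 h with e | e
      · exact absurd e.symm hne
      · exact e
    exact List.Sublist.cons_cons G (List.singleton_sublist.2 h')

theorem existsUnique_boutOp (μ : C.Path) (n : Fin C.numBouts) :
    ∃! T : K →L[ℂ] K, ∀ x y : (∀ q, C.regSpace q), ⟪C.tensor.tprod y, T (C.tensor.tprod x)⟫_ℂ =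
      (∏ G ∈ C.bout n, ⟪(C.gateTensor G).tprod (fun q => y q),
        gateOp μ G ((C.gateTensor G).tprod (fun q => x q))⟫_ℂ) *
        ∏ q with ∀ G ∈ C.bout n, ¬ G ∈ C.wire q, ⟪y q, x q⟫_ℂ :=
  C.tensor.existsUnique_tensorOp (C.bout n) (fun G q => G ∈ C.wire q)
    (bout_wire_disjoint n) C.gateTensor (gateOp μ)

/-- The operator on `K` performed by the `n`-th bout along the path `μ`: the tensor product of the
operators of the outcomes `μ(G)`, for the gates `G` in the bout, and of the identity operators on
the registers untouched by the bout. -/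
noncomputable def boutOp (μ : C.Path) (n : Fin C.numBouts) : K →L[ℂ] K :=
  (existsUnique_boutOp μ n).choose

/-- `Out_C(μ | σ)`: the bouts are executed one after another, producing the outcomes given by `μ`. -/
noncomputable def out (μ : C.Path) (σ : DensityOperator K) : K →L[ℂ] K :=
  runState (List.ofFn (boutOp μ)) σ.op

/-- `P_C(μ | σ)`: the probability that the computation on input `σ` follows `μ`. -/
noncomputable def prob (μ : C.Path) (σ : DensityOperator K) : ℝ :=
  runProb (List.ofFn (boutOp μ)) σ.op

end QuantumCircuit

/-! The tree performs one measurement per bout. A node at level `n` stands for a history of outcomes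
of the gates in the first `n` bouts. All classical sources of a gate in the next bout lie in earlier
bouts, so the history fixes the measurement selected at each of these gates; the node carries the
tensor product of the selected measurements, ampliated to `K`. A branch then records coherent
outcomes of all gates, that is, a path (`branchEquiv`, `pathEquivBranch`). The operators along the
branch are the bout operators of that path (`branchOps_pathEquivBranch`), and both the final state
and the probability are functions of this list and of the input.

The analytic content is that each node really carries a measurement. By polarization, `∑ i, (L i)† L
i = 1` in the weak operator topology is equivalent to `∑ i, ‖L i ξ‖² = ‖ξ‖²` for all `ξ`. Written in
`[0, ∞]`, this identity includes convergence and allows iterated sums to be exchanged freely, so the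
gates of a bout can be treated one at a time (`tsum_enorm_sq_isTensorOp`). For a single gate the
identity comes from inner products of product vectors, and `tsum_enorm_sq_eq_of_dense_span` carries
it to all of `K`. The complementary tensor factor is never built as a space: bounded insertions of
fixed vectors (`exists_insertion`) take its place. -/

/-! ### Families of operators with `∑ i, (L i)† L i = 1` -/

section Resolution

variable {ι E F : Type*} [NormedAddCommGroup E] [InnerProductSpace ℂ E]
  [NormedAddCommGroup F] [InnerProductSpace ℂ F]

theorem hasSum_ofCLM_iff_inner [CompleteSpace E] (L : ι → E →L[ℂ] E) :
    HasSum (fun i => ContinuousLinearMapWOT.ofCLM (ContinuousLinearMap.adjoint (L i) * L i))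
      (ContinuousLinearMapWOT.ofCLM (1 : E →L[ℂ] E)) ↔
    ∀ x y, HasSum (fun i => ⟪L i y, L i x⟫_ℂ) ⟪y, x⟫_ℂ := by
  unfold HasSum
  rw [ContinuousLinearMapWOT.tendsto_iff_forall_inner_apply_tendsto]
  refine forall₂_congr fun x y => ?_
  have h : ∀ s : Finset ι, ⟪y, (∑ i ∈ s, ContinuousLinearMapWOT.ofCLM
      (ContinuousLinearMap.adjoint (L i) * L i)) x⟫_ℂ = ∑ i ∈ s, ⟪L i y, L i x⟫_ℂ := by
    classical
    intro s
    induction s using Finset.induction_on with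
    | empty => simp
    | insert a s ha ih =>
      rw [Finset.sum_insert ha, Finset.sum_insert ha, ContinuousLinearMapWOT.add_apply,
        inner_add_right, ih, ContinuousLinearMapWOT.ofCLM_apply, mul_apply_eq_comp,
        ContinuousLinearMap.adjoint_inner_right]
  simp only [h]
  rfl

/-- A sum in `[0, ∞]` always exists, and its equality with the finite number `‖x‖ₑ ^ 2` already
forces summability of the real series. -/
theorem tsum_enorm_sq_eq_iff_hasSum_inner (L : ι → E →L[ℂ] F) (x : E) :
    ∑' i, ‖L i x‖ₑ ^ 2 = ‖x‖ₑ ^ 2 ↔ HasSum (fun i => ⟪L i x, L i x⟫_ℂ) ⟪x, x⟫_ℂ := by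
  have hr : HasSum (fun i => ⟪L i x, L i x⟫_ℂ) ⟪x, x⟫_ℂ ↔
      HasSum (fun i => ‖L i x‖ ^ 2) (‖x‖ ^ 2) := by
    simp only [inner_self_eq_norm_sq_to_K, ← Complex.ofReal_pow, Complex.coe_algebraMap]
    exact Complex.hasSum_ofReal
  have e1 : ‖x‖ₑ ^ 2 = ENNReal.ofReal (‖x‖ ^ 2) := by
    rw [← ofReal_norm, ENNReal.ofReal_pow (norm_nonneg x)]
  have e2 : ∀ i, ‖L i x‖ₑ ^ 2 = ENNReal.ofReal (‖L i x‖ ^ 2) := fun i => by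
    rw [← ofReal_norm, ENNReal.ofReal_pow (norm_nonneg _)]
  simp only [hr, e1, e2]
  constructor
  · intro h
    have hs : Summable fun i => ‖L i x‖ ^ 2 := by
      have := ENNReal.summable_toReal (h.trans_ne ENNReal.ofReal_ne_top)
      simpa only [ENNReal.toReal_ofReal (sq_nonneg _)] using this
    rw [← ENNReal.ofReal_tsum_of_nonneg (fun _ => sq_nonneg _) hs,
      ENNReal.ofReal_eq_ofReal_iff (tsum_nonneg fun _ => sq_nonneg _) (sq_nonneg _)] at h
    exact h ▸ hs.hasSum
  · intro h
    rw [← ENNReal.ofReal_tsum_of_nonneg (fun _ => sq_nonneg _) h.summable, h.tsum_eq]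

/-- Polarization: the inner product is a finite combination of squared norms, and `L i` is linear.
-/
theorem hasSum_inner_of_tsum_enorm_sq_eq {L : ι → E →L[ℂ] F}
    (h : ∀ x, ∑' i, ‖L i x‖ₑ ^ 2 = ‖x‖ₑ ^ 2) (x y : E) :
    HasSum (fun i => ⟪L i y, L i x⟫_ℂ) ⟪y, x⟫_ℂ := by
  have hc : ∀ z, HasSum (fun i => (‖L i z‖ : ℂ) ^ 2) ((‖z‖ : ℂ) ^ 2) := fun z => by
    simpa [inner_self_eq_norm_sq_to_K] using (tsum_enorm_sq_eq_iff_hasSum_inner L z).1 (h z)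
  simp only [inner_eq_sum_norm_sq_div_four (𝕜 := ℂ), ← map_add, ← map_sub, ← map_smul]
  exact ((((hc _).sub (hc _)).add (((hc _).sub (hc _)).mul_right _)).div_const _)

theorem parallelogram_enorm (x y : E) :
    ‖x + y‖ₑ ^ 2 + ‖x - y‖ₑ ^ 2 = 2 * (‖x‖ₑ ^ 2 + ‖y‖ₑ ^ 2) := by
  have h := parallelogram_law_with_norm ℂ x y
  simp only [← ofReal_norm]
  rw [← ENNReal.ofReal_pow (norm_nonneg _), ← ENNReal.ofReal_pow (norm_nonneg _),
    ← ENNReal.ofReal_pow (norm_nonneg _), ← ENNReal.ofReal_pow (norm_nonneg _),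
    ← ENNReal.ofReal_add (by positivity) (by positivity),
    ← ENNReal.ofReal_add (by positivity) (by positivity), ← ENNReal.ofReal_ofNat,
    ← ENNReal.ofReal_mul (by positivity)]
  congr 1

/-- The bound `≤` is a closed condition for each finite partial sum. For `≥`, the parallelogram law
applied to `L i d` and `L i (x - d)` bounds `2 * ‖L i d‖²` by `‖L i x‖² + ‖L i (2d - x)‖²`; summing
over `i` and letting `d` tend to `x` gives the claim. -/
theorem tsum_enorm_sq_eq_of_dense {L : ι → E →L[ℂ] F} {D : Set E} (hD : Dense D)
    (h : ∀ x ∈ D, ∑' i, ‖L i x‖ₑ ^ 2 = ‖x‖ₑ ^ 2) (x : E) :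
    ∑' i, ‖L i x‖ₑ ^ 2 = ‖x‖ₑ ^ 2 := by
  have hle : ∀ x, ∑' i, ‖L i x‖ₑ ^ 2 ≤ ‖x‖ₑ ^ 2 := fun x =>
    ENNReal.summable.tsum_le_of_sum_le fun s =>
      hD.induction (P := fun x => ∑ i ∈ s, ‖L i x‖ₑ ^ 2 ≤ ‖x‖ₑ ^ 2)
        (fun x hx => (h x hx) ▸ ENNReal.sum_le_tsum s)
        (isClosed_le (by fun_prop) (by fun_prop)) x
  refine le_antisymm (hle x) ?_
  -- The infinite sum involves only the fixed `x`, so the inequality is closed in the variable `d`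
  -- without any continuity of infinite sums; the value `d = x` is the one wanted.
  have key : 2 * ‖x‖ₑ ^ 2 ≤ ∑' i, ‖L i x‖ₑ ^ 2 + ‖x - (x - x)‖ₑ ^ 2 := by
    refine hD.induction (P := fun d => 2 * ‖d‖ₑ ^ 2 ≤ ∑' i, ‖L i x‖ₑ ^ 2 + ‖d - (x - d)‖ₑ ^ 2)
      (fun d hd => ?_) (isClosed_le ((ENNReal.continuous_const_mul (by simp)).comp (by fun_prop))
        (by fun_prop)) x
    calc 2 * ‖d‖ₑ ^ 2 = ∑' i, 2 * ‖L i d‖ₑ ^ 2 := by rw [ENNReal.tsum_mul_left, h d hd]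
      _ ≤ ∑' i, (‖L i x‖ₑ ^ 2 + ‖L i (d - (x - d))‖ₑ ^ 2) := by
        refine ENNReal.tsum_le_tsum fun i => ?_
        have := parallelogram_enorm (L i d) (L i (x - d))
        rw [← map_add, ← map_sub, add_sub_cancel] at this
        rw [this]
        gcongr
        exact le_self_add
      _ ≤ _ := by
        rw [ENNReal.tsum_add]
        gcongr
        exact hle _
  rw [sub_self, sub_zero, two_mul] at key
  exact ENNReal.le_of_add_le_add_right (by simp) key

/-- The norm identity on `D` alone would not pass to linear combinations; the sesquilinear form of
the hypothesis does, one argument at a time. -/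
theorem tsum_enorm_sq_eq_of_dense_span {L : ι → E →L[ℂ] F} {D : Set E}
    (hD : Dense (Submodule.span ℂ D : Set E))
    (h : ∀ x ∈ D, ∀ y ∈ D, HasSum (fun i => ⟪L i y, L i x⟫_ℂ) ⟪y, x⟫_ℂ) (x : E) :
    ∑' i, ‖L i x‖ₑ ^ 2 = ‖x‖ₑ ^ 2 := by
  have h1 : ∀ x ∈ Submodule.span ℂ D, ∀ y ∈ D,
      HasSum (fun i => ⟪L i y, L i x⟫_ℂ) ⟪y, x⟫_ℂ := by
    intro x hx y hy
    induction hx using Submodule.span_induction with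
    | mem x hx => exact h x hx y hy
    | zero => simp
    | add a b _ _ ha hb => simpa only [map_add, inner_add_right] using ha.add hb
    | smul c a _ ha => simpa only [map_smul, inner_smul_right] using ha.mul_left c
  have h2 : ∀ x ∈ Submodule.span ℂ D, ∀ y ∈ Submodule.span ℂ D,
      HasSum (fun i => ⟪L i y, L i x⟫_ℂ) ⟪y, x⟫_ℂ := by
    intro x hx y hy
    induction hy using Submodule.span_induction with
    | mem y hy => exact h1 x hx y hy
    | zero => simp
    | add a b _ _ ha hb => simpa only [map_add, inner_add_left] using ha.add hb
    | smul c a _ ha => simpa only [map_smul, inner_smul_left] using ha.mul_left (conj c)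
  exact tsum_enorm_sq_eq_of_dense hD
    (fun x hx => (tsum_enorm_sq_eq_iff_hasSum_inner L x).2 (h2 x hx x hx)) x

end Resolution

/-! ### Ampliations of operators to a tensor product -/

namespace HilbertTensor

section Splice

variable {ι : Type*} {H : ι → Type*} {S : ι → Prop} [DecidablePred S]

/-- Replace the coordinates `x i` with `S i` by those of `z`. -/
def splice (x : ∀ i, H i) (z : ∀ i : {i // S i}, H i) : ∀ i, H i :=
  fun i => if h : S i then z ⟨i, h⟩ else x i

theorem splice_of_pos (x : ∀ i, H i) (z : ∀ i : {i // S i}, H i) (i : {i // S i}) :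
    splice x z i = z i := by
  simp [splice, i.2]

theorem splice_of_neg (x : ∀ i, H i) (z : ∀ i : {i // S i}, H i) {i : ι} (h : ¬ S i) :
    splice x z i = x i := by
  simp [splice, h]

end Splice

section Ampliation

variable {ι : Type*} [Fintype ι] {H : ι → Type*}
  [∀ i, NormedAddCommGroup (H i)] [∀ i, InnerProductSpace ℂ (H i)]
  {K L : Type*} [NormedAddCommGroup K] [InnerProductSpace ℂ K]
  [NormedAddCommGroup L] [InnerProductSpace ℂ L]

theorem ext_clm (τ : HilbertTensor H K) {M : Type*} [NormedAddCommGroup M] [NormedSpace ℂ M]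
    {f g : K →L[ℂ] M} (h : ∀ x, f (τ.tprod x) = g (τ.tprod x)) : f = g :=
  ContinuousLinearMap.ext_on τ.dense_span (by rintro _ ⟨x, rfl⟩; exact h x)

theorem ext_inner (τ : HilbertTensor H K) {v w : K}
    (h : ∀ y, ⟪τ.tprod y, v⟫_ℂ = ⟪τ.tprod y, w⟫_ℂ) : v = w := by
  refine (innerSL_inj (𝕜 := ℂ)).1 (τ.ext_clm fun y => ?_)
  simpa only [innerSL_apply_apply, inner_conj_symm] using congrArg conj (h y)

variable {S : ι → Prop} [DecidablePred S]

theorem inner_tprod_eq_mul (τ : HilbertTensor H K)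
    (τL : HilbertTensor (fun i : {i // S i} => H i) L) (x y : ∀ i, H i) :
    ⟪τ.tprod y, τ.tprod x⟫_ℂ =
      ⟪τL.tprod fun i => y i, τL.tprod fun i => x i⟫_ℂ * ∏ i with ¬ S i, ⟪y i, x i⟫_ℂ := by
  rw [τ.inner_tprod, τL.inner_tprod, ← Finset.prod_filter_mul_prod_filter_not Finset.univ S]
  congr 1
  exact Finset.prod_subtype (Finset.univ.filter S) (by simp) (fun i => ⟪y i, x i⟫_ℂ)

theorem inner_tprod_splice (τ : HilbertTensor H K)
    (τL : HilbertTensor (fun i : {i // S i} => H i) L) (x y : ∀ i, H i)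
    (z : ∀ i : {i // S i}, H i) :
    ⟪τ.tprod y, τ.tprod (splice x z)⟫_ℂ =
      ⟪τL.tprod fun i => y i, τL.tprod z⟫_ℂ * ∏ i with ¬ S i, ⟪y i, x i⟫_ℂ := by
  rw [inner_tprod_eq_mul τ τL]
  simp only [splice_of_pos]
  congr 1
  refine Finset.prod_congr rfl fun i hi => ?_
  rw [splice_of_neg x z (Finset.mem_filter.1 hi).2]

/-- Inserting the fixed vectors `x i`, `¬ S i`, as further tensor factors is a bounded operator. -/
theorem exists_insertion [CompleteSpace K] (τ : HilbertTensor H K)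
    (τL : HilbertTensor (fun i : {i // S i} => H i) L) (x : ∀ i, H i) :
    ∃ V : L →L[ℂ] K, ∀ z, V (τL.tprod z) = τ.tprod (splice x z) := by
  set t : (∀ i : {i // S i}, H i) → L := fun z => τL.tprod z
  set s : (∀ i : {i // S i}, H i) → K := fun z => τ.tprod (splice x z)
  set c : ℝ := ∏ i with ¬ S i, ‖x i‖ ^ 2 with hc
  have hc0 : 0 ≤ c := Finset.prod_nonneg fun _ _ => sq_nonneg _
  have hd : DenseRange (Finsupp.linearCombination ℂ t) := by
    rw [DenseRange, ← LinearMap.coe_range, Finsupp.range_linearCombination]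
    exact τL.dense_span
  have hk : ∀ z w, ⟪s z, s w⟫_ℂ = c * ⟪t z, t w⟫_ℂ := by
    intro z w
    simp only [s, t]
    rw [inner_tprod_splice τ τL]
    simp only [splice_of_pos]
    rw [mul_comm, hc, Complex.ofReal_prod]
    congr 1
    refine Finset.prod_congr rfl fun i hi => ?_
    rw [splice_of_neg x z (Finset.mem_filter.1 hi).2, inner_self_eq_norm_sq_to_K]
    norm_cast
  -- By `hk` the Gram kernel of `s` is `c` times that of `t`, so insertion scales norms on linear
  -- combinations by exactly `√c`; this makes the extension from the dense range possible.
  have hn : ∀ v, ‖Finsupp.linearCombination ℂ s v‖ ≤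
      √c * ‖Finsupp.linearCombination ℂ t v‖ := by
    intro v
    have h1 := kernel_sum_eq s 1 v
    have h2 := kernel_sum_eq t c v
    simp only [hk, Complex.ofReal_one, one_mul] at h1
    have h3 := Complex.ofReal_injective (h1.symm.trans h2)
    rw [← pow_le_pow_iff_left₀ (norm_nonneg _) (by positivity) two_ne_zero, mul_pow,
      Real.sq_sqrt hc0]
    exact h3.le
  refine ⟨(Finsupp.linearCombination ℂ s).extendOfNorm (Finsupp.linearCombination ℂ t),
    fun z => ?_⟩
  simpa using LinearMap.extendOfNorm_eq (f := Finsupp.linearCombination ℂ s) hd ⟨_, hn⟩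
    (Finsupp.single z 1)

theorem inner_tprod_insertion (τ : HilbertTensor H K)
    (τL : HilbertTensor (fun i : {i // S i} => H i) L) {x : ∀ i, H i} {V : L →L[ℂ] K}
    (hV : ∀ z, V (τL.tprod z) = τ.tprod (splice x z)) (y : ∀ i, H i) (l : L) :
    ⟪τ.tprod y, V l⟫_ℂ = ⟪τL.tprod fun i => y i, l⟫_ℂ * ∏ i with ¬ S i, ⟪y i, x i⟫_ℂ := by
  have h : (innerSL ℂ (τ.tprod y)).comp V =
      (∏ i with ¬ S i, ⟪y i, x i⟫_ℂ) • innerSL ℂ (τL.tprod fun i => y i) :=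
    τL.ext_clm fun z => by
      simp [hV, inner_tprod_splice τ τL, mul_comm]
  simpa [mul_comm] using DFunLike.congr_fun h l

/-- This says that `W† V` is the scalar `∏ ⟪y i, x i⟫` over the coordinates outside `S`. The
argument `l` is handled by `inner_tprod_insertion`, and `m` by density of product vectors. -/
theorem inner_insertion_insertion (τ : HilbertTensor H K)
    (τL : HilbertTensor (fun i : {i // S i} => H i) L) {x y : ∀ i, H i} {V W : L →L[ℂ] K}
    (hV : ∀ z, V (τL.tprod z) = τ.tprod (splice x z))
    (hW : ∀ z, W (τL.tprod z) = τ.tprod (splice y z)) (l m : L) :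
    ⟪W m, V l⟫_ℂ = ⟪m, l⟫_ℂ * ∏ i with ¬ S i, ⟪y i, x i⟫_ℂ := by
  -- The inner product is conjugate-linear in `m`, so its conjugate is the functional to which
  -- density is applied.
  have h : (innerSL ℂ (V l)).comp W =
      conj (∏ i with ¬ S i, ⟪y i, x i⟫_ℂ) • innerSL ℂ l :=
    τL.ext_clm fun z => by
      have := congrArg conj (inner_tprod_insertion τ τL hV (splice y z) l)
      simp only [splice_of_pos] at this
      rw [inner_conj_symm, map_mul, inner_conj_symm] at this
      simp only [ContinuousLinearMap.comp_apply, hW, innerSL_apply_apply, this,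
        smul_apply, smul_eq_mul]
      rw [mul_comm]
      congr 2
      refine Finset.prod_congr rfl fun i hi => ?_
      rw [splice_of_neg y z (Finset.mem_filter.1 hi).2]
  have := congrArg conj (DFunLike.congr_fun h m)
  simpa [mul_comm, -map_prod] using this

/-- `T` acts as `A` on the tensor factor `L` of `K` and as the identity on the other factors. -/
def IsAmpliation (τ : HilbertTensor H K) (τL : HilbertTensor (fun i : {i // S i} => H i) L)
    (A : L →L[ℂ] L) (T : K →L[ℂ] K) : Prop :=
  ∀ x y, ⟪τ.tprod y, T (τ.tprod x)⟫_ℂ =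
    ⟪τL.tprod fun i => y i, A (τL.tprod fun i => x i)⟫_ℂ * ∏ i with ¬ S i, ⟪y i, x i⟫_ℂ

namespace IsAmpliation

variable {τ : HilbertTensor H K} {τL : HilbertTensor (fun i : {i // S i} => H i) L}
  {A : L →L[ℂ] L} {T : K →L[ℂ] K}

/-- The vector `A (τL.tprod _)` need not be a product vector, so the value of `T` can only be
expressed through the insertion `V`. -/
theorem apply_tprod (h : IsAmpliation τ τL A T) {x : ∀ i, H i} {V : L →L[ℂ] K}
    (hV : ∀ z, V (τL.tprod z) = τ.tprod (splice x z)) :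
    T (τ.tprod x) = V (A (τL.tprod fun i => x i)) :=
  τ.ext_inner fun y => by rw [h, inner_tprod_insertion τ τL hV]

theorem adjoint [CompleteSpace K] [CompleteSpace L] (h : IsAmpliation τ τL A T) :
    IsAmpliation τ τL (ContinuousLinearMap.adjoint A) (ContinuousLinearMap.adjoint T) := by
  intro x y
  rw [ContinuousLinearMap.adjoint_inner_right, ContinuousLinearMap.adjoint_inner_right,
    ← inner_conj_symm, h, map_mul, inner_conj_symm, map_prod]
  simp only [inner_conj_symm]

/-- On product vectors `⟪T k y, T k x⟫` is `⟪A k y, A k x⟫` times a factor independent of `k`, so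
completeness of the family `A` gives that of `T`. -/
theorem tsum_enorm_sq_eq [CompleteSpace K] {κ : Type*} {A : κ → L →L[ℂ] L} {T : κ → K →L[ℂ] K}
    (h : ∀ k, IsAmpliation τ τL (A k) (T k))
    (hA : ∀ x y, HasSum (fun k => ⟪A k y, A k x⟫_ℂ) ⟪y, x⟫_ℂ) (ξ : K) :
    ∑' k, ‖T k ξ‖ₑ ^ 2 = ‖ξ‖ₑ ^ 2 := by
  refine tsum_enorm_sq_eq_of_dense_span τ.dense_span ?_ ξ
  rintro _ ⟨x, rfl⟩ _ ⟨y, rfl⟩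
  obtain ⟨V, hV⟩ := exists_insertion τ τL x
  obtain ⟨W, hW⟩ := exists_insertion τ τL y
  simp only [(h _).apply_tprod hV, (h _).apply_tprod hW,
    inner_insertion_insertion τ τL hV hW, inner_tprod_eq_mul τ τL x y]
  exact (hA _ _).mul_right _

end IsAmpliation

end Ampliation

/-! ### Tensor products of operators on disjoint groups of factors -/

section TensorOp

variable {ι γ : Type*} [Fintype ι] {H : ι → Type*}
  [∀ i, NormedAddCommGroup (H i)] [∀ i, InnerProductSpace ℂ (H i)]
  {K : Type*} [NormedAddCommGroup K] [InnerProductSpace ℂ K]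
  {L : γ → Type*} [∀ g, NormedAddCommGroup (L g)] [∀ g, InnerProductSpace ℂ (L g)]
  {S : γ → ι → Prop} [∀ g, DecidablePred (S g)]

/-- `T` acts as `A g` on the tensor factors `L g`, `g ∈ J`, and as the identity on the others. -/
def IsTensorOp (τ : HilbertTensor H K) (τL : ∀ g, HilbertTensor (fun i : {i // S g i} => H i) (L g))
    (J : Finset γ) (A : ∀ g, L g →L[ℂ] L g) (T : K →L[ℂ] K) : Prop :=
  ∀ x y : (∀ i, H i), ⟪τ.tprod y, T (τ.tprod x)⟫_ℂ =
    (∏ g ∈ J, ⟪(τL g).tprod (fun i => y i), A g ((τL g).tprod (fun i => x i))⟫_ℂ) *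
      ∏ i with ∀ g ∈ J, ¬ S g i, ⟪y i, x i⟫_ℂ

variable {τ : HilbertTensor H K} {τL : ∀ g, HilbertTensor (fun i : {i // S g i} => H i) (L g)}
  {J : Finset γ} {A : ∀ g, L g →L[ℂ] L g} {T : K →L[ℂ] K}

theorem IsTensorOp.congr {B : ∀ g, L g →L[ℂ] L g} (h : IsTensorOp τ τL J A T)
    (hAB : ∀ g ∈ J, A g = B g) : IsTensorOp τ τL J B T := by
  intro x y
  rw [h x y]
  congr 1
  exact Finset.prod_congr rfl fun g hg => by rw [hAB g hg]

theorem IsTensorOp.unique {T' : K →L[ℂ] K} (h : IsTensorOp τ τL J A T)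
    (h' : IsTensorOp τ τL J A T') : T = T' :=
  τ.ext_clm fun x => τ.ext_inner fun y => (h x y).trans (h' x y).symm

theorem isTensorOp_empty_iff : IsTensorOp τ τL ∅ A T ↔ T = 1 := by
  have h1 : IsTensorOp τ τL ∅ A (1 : K →L[ℂ] K) := fun x y => by
    simp [τ.inner_tprod]
  exact ⟨fun h => h.unique h1, fun h => h ▸ h1⟩

theorem isTensorOp_singleton_iff {a : γ} :
    IsTensorOp τ τL {a} A T ↔ IsAmpliation τ (τL a) (A a) T := by
  simp [IsTensorOp, IsAmpliation]

/-- Moving `U` to the left gives `⟪U† y, T x⟫`, where `U† y` is the insertion `V` of `(A a)† y`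
restricted to the factors of `a`. Since `T` acts as the identity on those factors, its matrix
elements against the range of `V` are explicit. -/
theorem IsAmpliation.mul_isTensorOp [DecidableEq γ] [CompleteSpace K] {a : γ}
    [CompleteSpace (L a)] {U : K →L[ℂ] K}
    (hU : IsAmpliation τ (τL a) (A a) U) (hT : IsTensorOp τ τL J A T) (ha : a ∉ J)
    (hS : ∀ g ∈ J, ∀ i, S g i → ¬ S a i) : IsTensorOp τ τL (insert a J) A (U * T) := by
  intro x y
  obtain ⟨V, hV⟩ := exists_insertion τ (τL a) y
  -- The scalar `c` collects the factors of the matrix element of `T` outside `S a`; by disjointness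
  -- they do not change when the coordinates in `S a` are replaced by `z`.
  set c : ℂ := (∏ g ∈ J, ⟪(τL g).tprod (fun i => y i), A g ((τL g).tprod (fun i => x i))⟫_ℂ) *
      ∏ i with ∀ g ∈ insert a J, ¬ S g i, ⟪y i, x i⟫_ℂ with hc
  have h1 : ∀ z, ⟪τ.tprod (splice y z), T (τ.tprod x)⟫_ℂ =
      c * ⟪(τL a).tprod z, (τL a).tprod fun i => x i⟫_ℂ := by
    intro z
    rw [hT, hc, mul_assoc]
    congr 1
    · refine Finset.prod_congr rfl fun g hg => ?_
      congr 2
      funext i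
      exact splice_of_neg y z (hS g hg i i.2)
    · rw [← Finset.prod_filter_not_mul_prod_filter _ (S a), Finset.filter_filter,
        Finset.filter_filter]
      congr 1
      · refine Finset.prod_congr (by ext; simp [and_comm]) fun i hi => ?_
        rw [splice_of_neg y z (by simp_all)]
      · have e : ∀ i : {i // S a i}, ⟪z i, x i⟫_ℂ = ⟪splice y z i, x i⟫_ℂ := fun i => by
          rw [splice_of_pos]
        simp only [(τL a).inner_tprod, e]
        refine Finset.prod_subtype _ (fun i => ?_) (fun i => ⟪splice y z i, x i⟫_ℂ)
        simp only [Finset.mem_filter, Finset.mem_univ, true_and, and_iff_right_iff_imp]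
        exact fun hi g hg hgi => hS g hg i hgi hi
  have h2 : (innerSL ℂ (T (τ.tprod x))).comp V =
      conj c • innerSL ℂ ((τL a).tprod fun i => x i) :=
    (τL a).ext_clm fun z => by
      have := congrArg conj (h1 z)
      rw [inner_conj_symm, map_mul, inner_conj_symm] at this
      simpa [hV] using this
  -- The vector `(A a)† y` inserted here is not a product vector in general, which is why `h1` was
  -- first extended to all of `L a`.
  have h3 := congrArg conj (DFunLike.congr_fun h2
    (ContinuousLinearMap.adjoint (A a) ((τL a).tprod fun i => y i)))
  simp only [ContinuousLinearMap.comp_apply, innerSL_apply_apply, smul_apply,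
    smul_eq_mul, inner_conj_symm, map_mul, Complex.conj_conj, ← hU.adjoint.apply_tprod hV,
    ContinuousLinearMap.adjoint_inner_left] at h3
  rw [mul_apply_eq_comp, h3, Finset.prod_insert ha, hc]
  ring

theorem exists_isTensorOp [CompleteSpace K]
    (hS : ∀ g ∈ J, ∀ g' ∈ J, ∀ i, S g i → S g' i → g = g') (A : ∀ g, L g →L[ℂ] L g) :
    ∃ T, IsTensorOp τ τL J A T :=
  (τ.existsUnique_tensorOp J S hS τL A).exists

/-- The tensor product of finitely many measurements is a measurement. -/
theorem tsum_enorm_sq_isTensorOp [DecidableEq γ] [CompleteSpace K] [∀ g, CompleteSpace (L g)]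
    {O : γ → Type*} (B : ∀ g, O g → L g →L[ℂ] L g)
    (J : Finset γ)
    (hB : ∀ g ∈ J, ∀ x y, HasSum (fun o => ⟪B g o y, B g o x⟫_ℂ) ⟪y, x⟫_ℂ)
    (hS : ∀ g ∈ J, ∀ g' ∈ J, ∀ i, S g i → S g' i → g = g')
    (T : (∀ g ∈ J, O g) → K →L[ℂ] K)
    (hT : ∀ o A, (∀ g h, A g = B g (o g h)) → IsTensorOp τ τL J A (T o)) (ξ : K) :
    ∑' o, ‖T o ξ‖ₑ ^ 2 = ‖ξ‖ₑ ^ 2 := by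
  induction J using Finset.induction_on generalizing ξ with
  | empty =>
    have e : ∀ o, T o = 1 := fun o =>
      isTensorOp_empty_iff.1 (hT o (fun _ => 0) fun g h => absurd h (Finset.notMem_empty g))
    rw [tsum_eq_single (fun g h => absurd h (Finset.notMem_empty g))
      (fun o ho => absurd (by funext g h; exact absurd h (Finset.notMem_empty g)) ho), e]
    rfl
  | insert a J ha ih =>
    have hS' : ∀ g ∈ J, ∀ g' ∈ J, ∀ i, S g i → S g' i → g = g' := fun g hg g' hg' =>
      hS g (Finset.mem_insert_of_mem hg) g' (Finset.mem_insert_of_mem hg')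
    have hU : ∀ c : O a, ∃ U, IsAmpliation τ (τL a) (B a c) U := by
      intro c
      obtain ⟨U, hU⟩ := exists_isTensorOp (τ := τ) (τL := τL) (J := {a}) (by simp)
        (fun g => if h : g = a then B g (h ▸ c) else 0)
      exact ⟨U, by simpa using isTensorOp_singleton_iff.1 hU⟩
    choose U hU using hU
    -- The value `0` off `J` is arbitrary: only the factors in `J` enter `IsTensorOp`.
    choose T' hT' using fun o : (∀ g ∈ J, O g) => exists_isTensorOp (τ := τ) (τL := τL) hS'
      (fun g => if h : g ∈ J then B g (o g h) else 0)
    have hT'' : ∀ o A, (∀ g h, A g = B g (o g h)) → IsTensorOp τ τL J A (T' o) := fun o A hA =>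
      (hT' o).congr fun g hg => by rw [dif_pos hg, hA g hg]
    have hmul : ∀ p : O a × (∀ g ∈ J, O g),
        T ((Finset.insertPiProdEquiv O ha).symm p) = U p.1 * T' p.2 := by
      intro p
      obtain ⟨o, rfl⟩ := (Finset.insertPiProdEquiv O ha).surjective p
      rw [Equiv.symm_apply_apply]
      set A : ∀ g, L g →L[ℂ] L g := fun g => if h : g ∈ insert a J then B g (o g h) else 0
      have hA : ∀ g h, A g = B g (o g h) := fun g h => dif_pos h
      refine (hT o A hA).unique (IsAmpliation.mul_isTensorOp ?_ (hT'' _ A fun g hg => ?_) ha ?_)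
      · rw [hA a (Finset.mem_insert_self a J)]
        exact hU _
      · exact hA g (Finset.mem_insert_of_mem hg)
      · rintro g hg i hgi hai
        exact ha (hS g (Finset.mem_insert_of_mem hg) a (Finset.mem_insert_self a J) i hgi hai ▸ hg)
    -- A joint outcome is an outcome at `a` together with outcomes on `J`. After exchanging the
    -- sums, the inner one runs over the outcomes at `a` and is evaluated at the vector `T' o ξ`.
    rw [← (Finset.insertPiProdEquiv O ha).symm.tsum_eq, ENNReal.tsum_prod', ENNReal.tsum_comm]
    simp only [hmul, mul_apply_eq_comp]
    calc ∑' (o : ∀ g ∈ J, O g), ∑' c, ‖U c (T' o ξ)‖ₑ ^ 2 = ∑' o, ‖T' o ξ‖ₑ ^ 2 :=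
          tsum_congr fun o => IsAmpliation.tsum_enorm_sq_eq hU (hB a (Finset.mem_insert_self a J)) _
      _ = ‖ξ‖ₑ ^ 2 := ih (fun g hg => hB g (Finset.mem_insert_of_mem hg)) hS' T' hT'' ξ

end TensorOp

end HilbertTensor

/-! ### The measurement tree of a quantum circuit -/

namespace QuantumCircuit

variable {K : Type u} [NormedAddCommGroup K] [InnerProductSpace ℂ K] [CompleteSpace K]
  (C : QuantumCircuit.{u, v} K)

/-- Outcomes of all the gates in the first `n` bouts. -/
abbrev History (n : ℕ) : Type v :=
  ∀ G, (∃ k : Fin C.numBouts, (k : ℕ) < n ∧ G ∈ C.bout k) → C.GateOutcome G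

variable {C}

/-- The operator on `gateSpace G` belonging to an outcome of `G`. -/
def outcomeOp {G : C.Gate} (x : C.GateOutcome G) : C.gateSpace G →L[ℂ] C.gateSpace G :=
  (C.meas G x.1).op x.2

theorem exists_mem_bout_lt (n : Fin C.numBouts) {F G : C.Gate} (hG : G ∈ C.bout n)
    (h : C.Channel F G) : ∃ k : Fin C.numBouts, (k : ℕ) < n ∧ F ∈ C.bout k :=
  C.bout_prereq n G hG F (Or.inl h)

/-- The measurement that the history selects for a gate of bout `n`. -/
def selected {n : Fin C.numBouts} (p : C.History n) {G : C.Gate} (hG : G ∈ C.bout n) :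
    C.MeasIdx G :=
  C.select G fun F => p F (exists_mem_bout_lt n hG F.2)

/-- The joint outcomes of the measurements selected by a history for the gates of bout `n`. -/
abbrev BoutOutcome (n : Fin C.numBouts) (p : C.History n) : Type v :=
  ∀ G : C.Gate, G ∈ C.bout n → {x : C.GateOutcome G // ∀ hG : G ∈ C.bout n, x.1 = selected p hG}

/-- The operator on `K` belonging to outcomes of the gates of bout `n`. -/
noncomputable def jointOp (n : Fin C.numBouts) (f : ∀ G ∈ C.bout n, C.GateOutcome G) :
    K →L[ℂ] K :=
  (HilbertTensor.exists_isTensorOp (τ := C.tensor) (τL := C.gateTensor)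
    (S := fun G q => G ∈ C.wire q) (bout_wire_disjoint n)
    (fun G => if h : G ∈ C.bout n then outcomeOp (f G h) else 0)).choose

theorem jointOp_spec (n : Fin C.numBouts) (f : ∀ G ∈ C.bout n, C.GateOutcome G)
    (A : ∀ G, C.gateSpace G →L[ℂ] C.gateSpace G) (hA : ∀ G h, A G = outcomeOp (f G h)) :
    HilbertTensor.IsTensorOp (S := fun G q => G ∈ C.wire q) C.tensor C.gateTensor (C.bout n) A
      (jointOp n f) :=
  (HilbertTensor.exists_isTensorOp (τ := C.tensor) (τL := C.gateTensor)
    (S := fun G q => G ∈ C.wire q) (bout_wire_disjoint n)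
    (fun G => if h : G ∈ C.bout n then outcomeOp (f G h) else 0)).choose_spec.congr
    fun G h => by rw [dif_pos h, hA G h]

/-- The two operators are chosen separately, but their matrix elements between product vectors
determine them. -/
theorem jointOp_eq_boutOp (μ : C.Path) (n : Fin C.numBouts) :
    jointOp n (fun G _ => μ.outcome G) = boutOp μ n :=
  HilbertTensor.IsTensorOp.unique (jointOp_spec n _ (gateOp μ) fun _ _ => rfl)
    (existsUnique_boutOp μ n).choose_spec.1

theorem hasSum_inner_outcomeOp {G : C.Gate} (i : C.MeasIdx G) (x y : C.gateSpace G) :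
    HasSum (fun o : {x : C.GateOutcome G // x.1 = i} => ⟪outcomeOp o.1 y, outcomeOp o.1 x⟫_ℂ)
      ⟪y, x⟫_ℂ := by
  rw [← (Equiv.sigmaSubtype (β := fun i => (C.meas G i).Outcome) i).symm.hasSum_iff]
  exact (hasSum_ofCLM_iff_inner _).1 (C.meas G i).hasSum_id x y

theorem tsum_enorm_sq_jointOp (n : Fin C.numBouts) (p : C.History n) (ξ : K) :
    ∑' o : BoutOutcome n p, ‖jointOp n (fun G h => (o G h).1) ξ‖ₑ ^ 2 = ‖ξ‖ₑ ^ 2 := by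
  refine HilbertTensor.tsum_enorm_sq_isTensorOp (S := fun G q => G ∈ C.wire q) (τ := C.tensor)
    (τL := C.gateTensor)
    (O := fun G => {x : C.GateOutcome G // ∀ hG : G ∈ C.bout n, x.1 = selected p hG})
    (fun _ o => outcomeOp o.1) (C.bout n) (fun G hG x y => ?_) (bout_wire_disjoint n) _
    (fun o A hA => jointOp_spec n _ A hA) ξ
  -- The membership guard in `BoutOutcome` only serves to define the outcome type for every gate;
  -- for a gate of the bout it is dropped.
  rw [← (Equiv.subtypeEquivRight fun _ => (forall_prop_of_true hG).symm).hasSum_iff]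
  exact hasSum_inner_outcomeOp (selected p hG) x y

/-- The measurement over `K` performed by bout `n` after the given history. -/
noncomputable def boutMeas (n : Fin C.numBouts) (p : C.History n) : Measurement.{u, v} K where
  Outcome := BoutOutcome n p
  countable_outcome := by
    have : ∀ G i, Countable (C.meas G i).Outcome := fun G i => (C.meas G i).countable_outcome
    have : ∀ G, Finite (C.MeasIdx G) := C.finite_measIdx
    infer_instance
  op o := jointOp n fun G h => (o G h).1
  hasSum_id := (hasSum_ofCLM_iff_inner _).2
    (hasSum_inner_of_tsum_enorm_sq_eq (tsum_enorm_sq_jointOp n p))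

open Classical in
/-- Append the outcomes of bout `n` to a history. -/
noncomputable def History.snoc (n : Fin C.numBouts) (p : C.History n) (o : BoutOutcome n p) :
    C.History (n + 1) := fun G h =>
  if hG : G ∈ C.bout n then (o G hG).1 else p G (by
    obtain ⟨k, hk, hGk⟩ := h
    refine ⟨k, lt_of_le_of_ne (Nat.lt_succ_iff.1 hk) fun e => hG ?_, hGk⟩
    rwa [← Fin.ext e])

/-! ### The tree of bouts and its branches as coherent continuations -/

/-- The tree of the bouts from `n` on, `m` in number, after a history of the earlier ones. -/
noncomputable def treeAfter : (m n : ℕ) → n + m = C.numBouts → C.History n → OutcomeTree.{u, v} K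
  | 0, _, _, _ => .leaf
  | m + 1, n, h, p => .node (boutMeas ⟨n, by omega⟩ p) fun o =>
      treeAfter m (n + 1) (by omega) (p.snoc ⟨n, by omega⟩ o)

/-- Continuations of a history of the first `n` bouts, coherent in all later bouts. -/
def Continuation (n : ℕ) (p : C.History n) : Type v :=
  {f : ∀ G, C.GateOutcome G // (∀ G h, f G = p G h) ∧
    ∀ k : Fin C.numBouts, n ≤ k → ∀ G ∈ C.bout k, (f G).1 = C.select G fun F => f F}

/-- Every classical source of `G` lies in an earlier bout, where the continuation agrees with the
history. -/
theorem Continuation.coherent_selected {n : Fin C.numBouts} {p : C.History n}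
    (f : Continuation (n : ℕ) p) {G : C.Gate} (hG : G ∈ C.bout n) :
    (f.1 G).1 = selected p hG := by
  rw [f.2.2 n le_rfl G hG, selected]
  congr 1
  funext F
  exact f.2.1 _ _

theorem History.snoc_of_mem {n : Fin C.numBouts} (p : C.History n) (o : BoutOutcome n p)
    {G : C.Gate} (hG : G ∈ C.bout n) (h) : p.snoc n o G h = (o G hG).1 := dif_pos hG

theorem History.snoc_of_lt {n : Fin C.numBouts} (p : C.History n) (o : BoutOutcome n p)
    {G : C.Gate} (h : ∃ k : Fin C.numBouts, (k : ℕ) < n ∧ G ∈ C.bout k) (h') :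
    p.snoc n o G h' = p G h := by
  obtain ⟨k, hk, hGk⟩ := h
  exact dif_neg fun hG => Finset.disjoint_left.1 (C.bout_disjoint k n (Fin.ne_of_lt hk)) hGk hG

/-- A continuation after bout `n` is a continuation before it. -/
def Continuation.ofSnoc {n : Fin C.numBouts} {p : C.History n} {o : BoutOutcome n p}
    (f : Continuation ((n : ℕ) + 1) (p.snoc n o)) : Continuation (n : ℕ) p :=
  ⟨f.1, fun G h => by
      obtain ⟨k, hk, hGk⟩ := h
      rw [f.2.1 G ⟨k, by omega, hGk⟩, History.snoc_of_lt], fun k hk G hG => by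
      rcases hk.eq_or_lt with e | hlt
      · obtain rfl : n = k := Fin.ext e
        -- Coherence at bout `n` itself: the label `o` obeys the selection made from `p`, and `f`
        -- still agrees with `p` on the sources.
        have h1 : ∀ F, (h : ∃ k : Fin C.numBouts, (k : ℕ) < n ∧ F ∈ C.bout k) →
            f.1 F = p F h := fun F ⟨k, hk, hF⟩ => by
          rw [f.2.1 F ⟨k, by omega, hF⟩, History.snoc_of_lt]
        rw [f.2.1 G ⟨n, by omega, hG⟩, History.snoc_of_mem _ _ hG, (o G hG).2 hG, selected]
        congr 1
        funext F
        exact (h1 F _).symm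
      · exact f.2.2 k hlt G hG⟩

/-- A continuation splits into the outcomes of the next bout and a continuation after it. -/
noncomputable def sigmaContinuationEquiv (n : Fin C.numBouts) (p : C.History n) :
    (Σ o : BoutOutcome n p, Continuation ((n : ℕ) + 1) (p.snoc n o)) ≃ Continuation (n : ℕ) p where
  toFun s := s.2.ofSnoc
  invFun f := ⟨fun G hG => ⟨f.1 G, f.coherent_selected⟩, f.1, fun G h => by
      by_cases hG : G ∈ C.bout n
      · rw [History.snoc_of_mem _ _ hG]
      · obtain ⟨k, hk, hGk⟩ := h
        have hkn : k ≠ n := by rintro rfl; exact hG hGk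
        rw [History.snoc_of_lt _ _ ⟨k, by omega, hGk⟩]
        exact f.2.1 _ _, fun k hk => f.2.2 k (by omega)⟩
  left_inv := by
    rintro ⟨o, f⟩
    have ho : (fun G hG => ⟨f.1 G, f.ofSnoc.coherent_selected⟩) = o := by
      funext G hG
      refine Subtype.ext ?_
      rw [← History.snoc_of_mem p o hG ⟨n, by omega, hG⟩]
      exact f.2.1 _ _
    -- The type of the second component depends on the first; generalizing to `o'` allows
    -- substitution and avoids transport along `ho`.
    suffices ∀ o', o' = o → ∀ h, (⟨o', ⟨f.1, h⟩⟩ :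
        Σ o : BoutOutcome n p, Continuation ((n : ℕ) + 1) (p.snoc n o)) = ⟨o, f⟩ from this _ ho _
    rintro _ rfl _
    rfl
  right_inv _ := rfl

/-- Branches of the tree after a history are the continuations of the history. -/
noncomputable def branchEquiv : (m n : ℕ) → (h : n + m = C.numBouts) → (p : C.History n) →
    (treeAfter m n h p).Branch ≃ Continuation n p
  | 0, n, h, p =>
    -- Here `n` equals `C.numBouts`, so the history already covers every gate and no coherence
    -- condition remains.
    { toFun := fun _ => ⟨fun G => p G (by
        obtain ⟨k, hk⟩ := C.bout_cover G
        exact ⟨k, by omega, hk⟩), fun _ _ => rfl, fun k hk => by omega⟩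
      invFun := fun _ => PUnit.unit
      left_inv := fun _ => rfl
      right_inv := fun f => Subtype.ext (funext fun G => (f.2.1 G _).symm) }
  | m + 1, n, h, p =>
    (Equiv.sigmaCongrRight fun o =>
      branchEquiv m (n + 1) (by omega) (p.snoc ⟨n, by omega⟩ o)).trans
      (sigmaContinuationEquiv ⟨n, by omega⟩ p)

theorem branchLength_treeAfter : ∀ (m n : ℕ) (h : n + m = C.numBouts) (p : C.History n)
    (b : (treeAfter m n h p).Branch), (treeAfter m n h p).branchLength b = m
  | 0, _, _, _, _ => rfl
  | m + 1, n, h, p, ⟨o, b⟩ =>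
    congrArg (· + 1) (branchLength_treeAfter m (n + 1) (by omega) (p.snoc ⟨n, by omega⟩ o) b)

/-- The operator at each level depends only on the outcomes assigned to the gates of its bout, and
the continuation of the branch extends every history met on the way. -/
theorem branchOps_treeAfter : ∀ (m n : ℕ) (h : n + m = C.numBouts) (p : C.History n)
    (b : (treeAfter m n h p).Branch), (treeAfter m n h p).branchOps b =
      List.ofFn fun i : Fin m => jointOp ⟨n + i, by omega⟩ fun G _ => (branchEquiv m n h p b).1 G
  | 0, _, _, _, _ => rfl
  | m + 1, n, h, p, ⟨o, b⟩ => by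
    rw [List.ofFn_succ]
    refine congrArg₂ List.cons ?_
      ((branchOps_treeAfter m (n + 1) (by omega) (p.snoc ⟨n, by omega⟩ o) b).trans ?_)
    · have e : ∀ G (hG : G ∈ C.bout ⟨n, by omega⟩), (o G hG).1 =
          (branchEquiv m (n + 1) (by omega) (p.snoc ⟨n, by omega⟩ o) b).1 G := fun G hG =>
        (((branchEquiv m (n + 1) (by omega) (p.snoc ⟨n, by omega⟩ o) b).2.1 G
          ⟨⟨n, by omega⟩, by simp, hG⟩).trans (History.snoc_of_mem p o hG _)).symm
      exact congrArg (jointOp _) (funext fun G => funext fun hG => e G hG)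
    · refine congrArg List.ofFn (funext fun i => ?_)
      -- Only the index differs: bout `(n + 1) + i` against bout `n + (i + 1)`.
      exact congrArg (fun k => jointOp k fun G _ =>
        (branchEquiv m (n + 1) (by omega) (p.snoc ⟨n, by omega⟩ o) b).1 G)
        (Fin.ext (by simp only [Fin.val_succ]; omega))

/-- Continuations of the empty history are the paths. -/
def pathEquivContinuation (p : C.History 0) : C.Path ≃ Continuation 0 p where
  toFun μ := ⟨μ.outcome, fun G h => absurd h (by simp), fun _ _ G _ => μ.coherent G⟩
  invFun f := ⟨f.1, fun G => by
    obtain ⟨k, hk⟩ := C.bout_cover G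
    exact f.2.2 k (Nat.zero_le _) G hk⟩
  left_inv _ := rfl
  right_inv _ := rfl

variable (C) in
/-- The history of no bouts. -/
def emptyHistory : C.History 0 := fun _ h => absurd h (by simp)

variable (C) in
/-- The measurement tree with one measurement for every bout. -/
noncomputable def measTree : MeasTree.{u, v} K where
  tree := treeAfter C.numBouts 0 (Nat.zero_add _) C.emptyHistory
  bounded := ⟨C.numBouts, fun b => (branchLength_treeAfter _ _ _ _ b).le⟩

variable (C) in
/-- The branch belonging to a path. -/
noncomputable def pathEquivBranch : C.Path ≃ C.measTree.Branch :=
  (pathEquivContinuation C.emptyHistory).trans (branchEquiv _ _ _ _).symm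

theorem branchOps_pathEquivBranch (μ : C.Path) :
    C.measTree.tree.branchOps (C.pathEquivBranch μ) = List.ofFn (boutOp μ) := by
  refine (branchOps_treeAfter _ _ _ _ _).trans (congrArg List.ofFn (funext fun n => ?_))
  have e := (branchEquiv C.numBouts 0 (Nat.zero_add _) C.emptyHistory).apply_symm_apply
    (pathEquivContinuation C.emptyHistory μ)
  rw [← jointOp_eq_boutOp]
  -- The continuation attached to the branch of `μ` is `μ` itself, and position `n` in the list is
  -- bout `0 + n`.
  exact (congrArg (fun f : Continuation 0 C.emptyHistory => jointOp _ fun G _ => f.1 G) e).trans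
    (congrArg (fun k => jointOp k fun G _ => μ.outcome G) (Fin.ext (Nat.zero_add _)))

end QuantumCircuit

theorem theorem2p2 {K : Type u} [NormedAddCommGroup K] [InnerProductSpace ℂ K]
    [CompleteSpace K] [TopologicalSpace.SeparableSpace K] (C : QuantumCircuit.{u, v} K) :
    ∃ (T : MeasTree.{u, v} K) (β : C.Path ≃ T.Branch),
      ∀ (μ : C.Path) (σ : DensityOperator K),
        QuantumCircuit.out μ σ = T.out (β μ) σ ∧
          QuantumCircuit.prob μ σ = T.prob (β μ) σ := by
  refine ⟨C.measTree, C.pathEquivBranch, fun μ σ => ?_⟩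
  rw [MeasTree.out, MeasTree.prob, QuantumCircuit.branchOps_pathEquivBranch]
  -- Circuit and tree now run the same list of operators on the same input.
  exact ⟨rfl, rfl⟩
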